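/- Let $V\in L^\infty(\mathbb R)$ be real-valued with $0<v_0\le V(x)\le v_1$ for a.e. $x\in\mathbb R$, where $v_0,v_1$ are constants. Elements of $H^1(\mathbb R)$ and of $W^{2,\infty}_{loc}(\mathbb R)$ are real-valued and identified with their continuous representatives, and derivatives are weak derivatives. For $a\in\mathbb R$ put $$K_a:=\{u\in H^1(\mathbb R):\ u(a)=\|u\|_{L^\infty(\mathbb R)}=1\},\qquad \|u\|_V^2:=\int_{\mathbb R}\left(|u'(x)|^2+V(x)|u(x)|^2\right)dx .$$ There exist a unique $\varphi_+\in W^{2,\infty}_{loc}(\mathbb R)$ and a unique $\varphi_-\in W^{2,\infty}_{loc}(\mathbb R)$ such that $$\varphi_\pm''(x)=V(x)\varphi_\pm(x)\ \text{ for a.e. }x\in\mathbb R,\qquad \varphi_\pm(0)=1,\qquad \lim_{x\to\pm\infty}\varphi_\pm(x)=0$$ (upper signs for $\varphi_+$, lower signs for $\varphi_-$). They satisfy, for all $x\in\mathbb R$, $$\sqrt{\tfrac{v_0}{v_1}}\,e^{-\max(\sqrt{v_0}\,x,\sqrt{v_1}\,x)}\le\varphi_+(x)\le\sqrt{\tfrac{v_1}{v_0}}\,e^{-\min(\sqrt{v_0}\,x,\sqrt{v_1}\,x)},$$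 $$\sqrt{\tfrac{v_0}{v_1}}\,e^{\min(\sqrt{v_0}\,x,\sqrt{v_1}\,x)}\le\varphi_-(x)\le\sqrt{\tfrac{v_1}{v_0}}\,e^{\max(\sqrt{v_0}\,x,\sqrt{v_1}\,x)}.$$ Moreover, for every $a\in\mathbb R$ the functional $\|\cdot\|_V^2$ has exactly one minimizer $u_a$ over $K_a$, and it is given by $$u_a(x)=\begin{cases}\varphi_-(x)/\varphi_-(a) & (x<a),\\ \varphi_+(x)/\varphi_+(a) & (x\ge a).\end{cases}$$ -/

import Mathlib

open MeasureTheory Filter Topology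

/-- `g` is a weak derivative of order `k` of `u` on `ℝ`: both are locally integrable and
`∫ u ψ⁽ᵏ⁾ = (-1)ᵏ ∫ g ψ` for every real test function `ψ ∈ C_c^∞(ℝ)`. -/
def IsWeakDeriv (k : ℕ) (u g : ℝ → ℝ) : Prop :=
  LocallyIntegrable u volume ∧ LocallyIntegrable g volume ∧
    ∀ ψ : ℝ → ℝ, ContDiff ℝ (⊤ : ℕ∞) ψ → HasCompactSupport ψ →
      ∫ x, u x * iteratedDeriv k ψ x = (-1) ^ k * ∫ x, g x * ψ x

/-- Weak derivatives are unique up to null sets. -/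
theorem IsWeakDeriv.ae_eq {k : ℕ} {u g h : ℝ → ℝ}
    (hg : IsWeakDeriv k u g) (hh : IsWeakDeriv k u h) : g =ᵐ[volume] h := by
  refine ae_eq_of_integral_contDiff_smul_eq hg.2.1 hh.2.1 fun ψ hψ hc => ?_
  have e := (hg.2.2 ψ hψ hc).symm.trans (hh.2.2 ψ hψ hc)
  have e' := mul_left_cancel₀ (pow_ne_zero k (by norm_num : (-1 : ℝ) ≠ 0)) e
  simpa [smul_eq_mul, mul_comm] using e'

open Classical in
/-- The weak derivative of order `k` of `u` (well defined up to null sets by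
`IsWeakDeriv.ae_eq`), and `0` if there is none. -/
noncomputable def weakDeriv (k : ℕ) (u : ℝ → ℝ) : ℝ → ℝ :=
  if h : ∃ g, IsWeakDeriv k u g then h.choose else 0

theorem IsWeakDeriv.weakDeriv {k : ℕ} {u g : ℝ → ℝ} (hg : IsWeakDeriv k u g) :
    IsWeakDeriv k u (_root_.weakDeriv k u) := by
  have h : ∃ g, IsWeakDeriv k u g := ⟨g, hg⟩
  rw [_root_.weakDeriv, dif_pos h]
  exact h.choose_spec

/-- The Sobolev space `H¹(ℝ) = W^{1,2}(ℝ)` of real functions, each element being represented by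
its continuous representative. -/
def SobolevH1 : Set (ℝ → ℝ) :=
  {u | Continuous u ∧ MemLp u 2 volume ∧ ∃ g, IsWeakDeriv 1 u g ∧ MemLp g 2 volume}

/-- The space `L^∞_loc(ℝ)`. -/
def MemLinftyLoc (g : ℝ → ℝ) : Prop :=
  ∀ K : Set ℝ, IsCompact K → MemLp g ⊤ (volume.restrict K)

/-- The Sobolev space `W^{2,∞}_loc(ℝ)` of real functions, each element being represented by
its continuous representative. -/
def SobolevW2InftyLoc : Set (ℝ → ℝ) :=
  {u | Continuous u ∧ MemLinftyLoc u ∧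
    (∃ g, IsWeakDeriv 1 u g ∧ MemLinftyLoc g) ∧ (∃ h, IsWeakDeriv 2 u h ∧ MemLinftyLoc h)}

/-- `‖u‖_V² = ∫ (|u'|² + V |u|²) dx`. -/
noncomputable def energyV (V u : ℝ → ℝ) : ℝ :=
  ∫ x, ((weakDeriv 1 u x) ^ 2 + V x * (u x) ^ 2)

/-- `K_a = {u ∈ H¹(ℝ) : u(a) = ‖u‖_∞ = 1}`. -/
def peakSet (a : ℝ) : Set (ℝ → ℝ) :=
  {u | u ∈ SobolevH1 ∧ u a = 1 ∧ eLpNorm u ⊤ volume = 1}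

/-- `u` minimizes `‖·‖_V²` over `K_a`. -/
def IsPeakMinimizer (V : ℝ → ℝ) (a : ℝ) (u : ℝ → ℝ) : Prop :=
  u ∈ peakSet a ∧ ∀ w ∈ peakSet a, energyV V u ≤ energyV V w

/-- `φ ∈ W^{2,∞}_loc(ℝ)` satisfies `φ'' = V φ` a.e. on `ℝ`, `φ(0) = 1`, and `φ → 0` along the
filter `l` (used with `l = atTop` and `l = atBot`). -/
def IsDecayingSolution (V : ℝ → ℝ) (l : Filter ℝ) (φ : ℝ → ℝ) : Prop :=
  φ ∈ SobolevW2InftyLoc ∧ (∀ᵐ x, weakDeriv 2 φ x = V x * φ x) ∧ φ 0 = 1 ∧ Tendsto φ l (𝓝 0)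

/-- `f` is a locally absolutely continuous function on `ℝ` with a.e. derivative `g`. -/
def IsPrimitive (f g : ℝ → ℝ) : Prop :=
  LocallyIntegrable g volume ∧ ∀ x y, ∫ t in x..y, g t = f y - f x

namespace IsPrimitive

variable {f g f₁ g₁ f₂ g₂ : ℝ → ℝ}

theorem _root_.MeasureTheory.LocallyIntegrable.intervalIntegrable_real
    (hg : LocallyIntegrable g volume) (x y : ℝ) : IntervalIntegrable g volume x y :=
  (hg.integrableOn_isCompact isCompact_uIcc).intervalIntegrable

theorem of_base (hg : LocallyIntegrable g volume) (c : ℝ)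
    (h : ∀ x, ∫ t in c..x, g t = f x - f c) : IsPrimitive f g := by
  refine ⟨hg, fun x y => ?_⟩
  have := intervalIntegral.integral_interval_sub_left
    (hg.intervalIntegrable_real c y) (hg.intervalIntegrable_real c x)
  rw [← this, h, h]; ring

theorem integral_primitive (hg : LocallyIntegrable g volume) (c : ℝ) :
    IsPrimitive (fun x => ∫ t in c..x, g t) g :=
  of_base hg c fun x => by simp

theorem congr_ae (h : IsPrimitive f g) (hgg : g =ᵐ[volume] g₁) : IsPrimitive f g₁ := by
  refine ⟨(locallyIntegrable_congr hgg).1 h.1, fun x y => ?_⟩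
  rw [← h.2 x y]
  exact intervalIntegral.integral_congr_ae (hgg.mono fun t ht _ => ht.symm)

theorem of_hasDerivAt (h : ∀ x, HasDerivAt f (g x) x) (hg : Continuous g) : IsPrimitive f g :=
  ⟨hg.locallyIntegrable, fun x y => intervalIntegral.integral_eq_sub_of_hasDerivAt
    (fun t _ => h t) (hg.intervalIntegrable x y)⟩

theorem ae_hasDerivAt (h : IsPrimitive f g) : ∀ᵐ x, HasDerivAt f (g x) x := by
  have h1 : f = fun y => f 0 + ∫ t in (0 : ℝ)..y, g t := by
    funext y; rw [h.2 0 y]; ring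
  filter_upwards [LocallyIntegrable.ae_hasDerivAt_integral h.1] with x hx
  rw [h1]
  exact (hx 0).const_add _

theorem absolutelyContinuousOnInterval (h : IsPrimitive f g) (a b : ℝ) :
    AbsolutelyContinuousOnInterval f a b := by
  have h1 : f = fun y => f a + ∫ t in a..y, g t := by
    funext y; rw [h.2 a y]; ring
  have h2 := ((h.1.intervalIntegrable_real a b).absolutelyContinuousOnInterval_intervalIntegral
    (c := a) (by simp))
  have h3 : AbsolutelyContinuousOnInterval (fun _ : ℝ => f a) a b :=
    (contDiff_const (n := 1)).contDiffOn.absolutelyContinuousOnInterval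
  rw [h1]
  exact h3.add h2

theorem continuous (h : IsPrimitive f g) : Continuous f := by
  rw [continuous_iff_continuousAt]
  intro x
  refine ((h.absolutelyContinuousOnInterval (x - 1) (x + 1)).continuousOn).continuousAt ?_
  rw [Set.uIcc_of_le (by linarith)]
  exact Icc_mem_nhds (by linarith) (by linarith)

theorem mul (h₁ : IsPrimitive f₁ g₁) (h₂ : IsPrimitive f₂ g₂) :
    IsPrimitive (fun x => f₁ x * f₂ x) (fun x => g₁ x * f₂ x + g₂ x * f₁ x) := by
  refine ⟨(h₁.1.mul_continuous h₂.continuous).add (h₂.1.mul_continuous h₁.continuous),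
    fun x y => ?_⟩
  rw [← (h₁.absolutelyContinuousOnInterval x y).integral_deriv_mul_eq_sub
    (h₂.absolutelyContinuousOnInterval x y)]
  refine intervalIntegral.integral_congr_ae ?_
  filter_upwards [h₁.ae_hasDerivAt, h₂.ae_hasDerivAt] with t ht₁ ht₂ _
  rw [ht₁.deriv, ht₂.deriv]; ring

theorem add (h₁ : IsPrimitive f₁ g₁) (h₂ : IsPrimitive f₂ g₂) :
    IsPrimitive (fun x => f₁ x + f₂ x) (fun x => g₁ x + g₂ x) := by
  refine ⟨h₁.1.add h₂.1, fun x y => ?_⟩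
  rw [intervalIntegral.integral_add (h₁.1.intervalIntegrable_real x y)
    (h₂.1.intervalIntegrable_real x y), h₁.2, h₂.2]; ring

theorem const_mul (h : IsPrimitive f g) (c : ℝ) :
    IsPrimitive (fun x => c * f x) (fun x => c * g x) := by
  refine ⟨h.1.smul c, fun x y => ?_⟩
  rw [intervalIntegral.integral_const_mul, h.2]; ring

theorem sub (h₁ : IsPrimitive f₁ g₁) (h₂ : IsPrimitive f₂ g₂) :
    IsPrimitive (fun x => f₁ x - f₂ x) (fun x => g₁ x - g₂ x) := by
  simpa [sub_eq_add_neg] using h₁.add (h₂.const_mul (-1))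

theorem comp_neg (h : IsPrimitive f g) : IsPrimitive (fun x => f (-x)) (fun x => -g (-x)) := by
  have h0 : LocallyIntegrable (fun x => g (-x)) volume := by
    rw [locallyIntegrable_iff]
    intro K hK
    have := (Measure.measurePreserving_neg (volume : Measure ℝ)).integrableOn_comp_preimage
      (MeasurableEquiv.neg ℝ).measurableEmbedding (f := g) (s := -K)
    have h2 := this.2 (h.1.integrableOn_isCompact hK.neg)
    have h3 : (Neg.neg ⁻¹' (-K) : Set ℝ) = K := by ext x; simp
    rw [h3] at h2
    exact h2
  refine ⟨h0.neg, fun x y => ?_⟩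
  rw [intervalIntegral.integral_neg, intervalIntegral.integral_comp_neg (fun t => g t),
    h.2]
  ring

theorem monotone (h : IsPrimitive f g) (hg : 0 ≤ᵐ[volume] g) : Monotone f := by
  intro x y hxy
  have := intervalIntegral.integral_nonneg_of_ae (a := x) (b := y) hxy hg
  rw [h.2] at this; linarith

theorem eq_of_ae_zero (h : IsPrimitive f g) (hg : g =ᵐ[volume] 0) (x y : ℝ) : f x = f y := by
  have := (h.congr_ae hg).2 x y
  simp at this
  linarith

theorem piecewise (h₁ : IsPrimitive f₁ g₁) (h₂ : IsPrimitive f₂ g₂) (a : ℝ) (ha : f₁ a = f₂ a) :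
    IsPrimitive (fun x => if x < a then f₁ x else f₂ x)
      (fun x => if x < a then g₁ x else g₂ x) := by
  have hli : LocallyIntegrable (fun x => if x < a then g₁ x else g₂ x) volume := by
    rw [locallyIntegrable_iff]
    intro K hK
    exact Integrable.piecewise (s := Set.Iio a) measurableSet_Iio
      (h₁.1.integrableOn_isCompact hK).integrableOn (h₂.1.integrableOn_isCompact hK).integrableOn
  refine of_base hli a fun x => ?_
  rcases lt_or_ge x a with hx | hx
  · simp only [hx, if_true, lt_irrefl, if_false]
    rw [← ha, ← h₁.2]
    refine intervalIntegral.integral_congr_ae ?_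
    filter_upwards [Measure.ae_ne volume a] with t hta ht
    rw [Set.uIoc_of_ge hx.le] at ht
    rw [if_pos (lt_of_le_of_ne ht.2 hta)]
  · simp only [not_lt.2 hx, lt_irrefl, if_false]
    rw [← h₂.2]
    refine intervalIntegral.integral_congr_ae (ae_of_all _ fun t ht => ?_)
    rw [Set.uIoc_of_le hx] at ht
    rw [if_neg (not_lt.2 ht.1.le)]

end IsPrimitive

theorem HasCompactSupport.exists_eq_zero_of_le_abs {ψ : ℝ → ℝ} (hc : HasCompactSupport ψ) :
    ∃ K, ∀ x, K ≤ |x| → ψ x = 0 := by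
  obtain ⟨K, hK⟩ := (Metric.isBounded_iff_subset_closedBall (0 : ℝ)).1 hc.isCompact.isBounded
  refine ⟨|K| + 1, fun x hx => ?_⟩
  by_contra h
  have := hK (subset_tsupport ψ h)
  rw [Metric.mem_closedBall, Real.dist_eq, sub_zero] at this
  linarith [le_abs_self K]

theorem integral_eq_intervalIntegral_of_eq_zero {f : ℝ → ℝ} {K : ℝ}
    (h : ∀ x, K ≤ |x| → f x = 0) : ∫ x, f x = ∫ x in (-K)..K, f x := by
  refine (intervalIntegral.integral_eq_integral_of_support_subset fun x hx => ?_).symm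
  have : |x| < K := not_le.1 fun h' => hx (h x h')
  exact ⟨(abs_lt.1 this).1, (abs_lt.1 this).2.le⟩

theorem integrable_mul_test {u ψ : ℝ → ℝ} (hu : LocallyIntegrable u volume)
    (hψ : Continuous ψ) (hc : HasCompactSupport ψ) : Integrable (fun x => u x * ψ x) volume := by
  simpa [smul_eq_mul, mul_comm] using hu.integrable_smul_left_of_hasCompactSupport hψ hc

theorem IsPrimitive.integral_mul_deriv {f g ψ : ℝ → ℝ} (h : IsPrimitive f g)
    (hψ : ContDiff ℝ (⊤ : ℕ∞) ψ) (hc : HasCompactSupport ψ) :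
    ∫ x, f x * deriv ψ x = -∫ x, g x * ψ x := by
  have hψ' : IsPrimitive ψ (deriv ψ) := .of_hasDerivAt
    (fun x => (hψ.differentiable (by simp) x).hasDerivAt) (hψ.continuous_deriv (by simp))
  obtain ⟨K, hK⟩ := hc.exists_eq_zero_of_le_abs
  obtain ⟨K', hK'⟩ := hc.deriv.exists_eq_zero_of_le_abs
  have h1 : Integrable (fun x => g x * ψ x) := integrable_mul_test h.1 hψ.continuous hc
  have h2 : Integrable (fun x => f x * deriv ψ x) :=
    integrable_mul_test h.continuous.locallyIntegrable (hψ.continuous_deriv (by simp)) hc.deriv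
  have h3 : ∫ x, (g x * ψ x + deriv ψ x * f x) = 0 := by
    rw [integral_eq_intervalIntegral_of_eq_zero (K := max K K'), (h.mul hψ').2]
    · beta_reduce
      rw [hK (max K K') ((le_max_left _ _).trans (le_abs_self _)),
        hK (-max K K') ((le_max_left _ _).trans (by rw [abs_neg]; exact le_abs_self _))]
      simp
    · intro x hx
      rw [hK x ((le_max_left _ _).trans hx), hK' x ((le_max_right _ _).trans hx)]; simp
  have h4 : ∫ x, (g x * ψ x + deriv ψ x * f x)
      = (∫ x, g x * ψ x) + ∫ x, f x * deriv ψ x := by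
    rw [← integral_add h1 h2]
    exact integral_congr_ae (ae_of_all _ fun x => by simp only []; ring)
  linarith

theorem IsPrimitive.isWeakDeriv {f g : ℝ → ℝ} (h : IsPrimitive f g) : IsWeakDeriv 1 f g :=
  ⟨h.continuous.locallyIntegrable, h.1, fun ψ hψ hc => by
    simpa [iteratedDeriv_one] using h.integral_mul_deriv hψ hc⟩

theorem IsWeakDeriv.congr_ae {k : ℕ} {u u' g g' : ℝ → ℝ} (h : IsWeakDeriv k u g)
    (hu : u =ᵐ[volume] u') (hg : g =ᵐ[volume] g') : IsWeakDeriv k u' g' := by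
  refine ⟨(locallyIntegrable_congr hu).1 h.1, (locallyIntegrable_congr hg).1 h.2.1,
    fun ψ hψ hc => ?_⟩
  have h1 : ∫ x, u' x * iteratedDeriv k ψ x = ∫ x, u x * iteratedDeriv k ψ x :=
    integral_congr_ae (hu.mono fun x hx => by simp only [hx])
  have h2 : ∫ x, g' x * ψ x = ∫ x, g x * ψ x :=
    integral_congr_ae (hg.mono fun x hx => by simp only [hx])
  rw [h1, h2, h.2.2 ψ hψ hc]

/-- A function that annihilates all derivatives of test functions is a.e. constant. -/
theorem ae_const_of_integral_mul_deriv_eq_zero {v : ℝ → ℝ} (hv : LocallyIntegrable v volume)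
    (h : ∀ ψ : ℝ → ℝ, ContDiff ℝ (⊤ : ℕ∞) ψ → HasCompactSupport ψ → ∫ x, v x * deriv ψ x = 0) :
    ∃ c : ℝ, v =ᵐ[volume] fun _ => c := by
  let b : ContDiffBump (0 : ℝ) := default
  set η : ℝ → ℝ := b.normed volume with hη
  have hηs : ContDiff ℝ (⊤ : ℕ∞) η := b.contDiff_normed
  have hηc : HasCompactSupport η := b.hasCompactSupport_normed
  have hη1 : ∫ x, η x = 1 := b.integral_normed
  refine ⟨∫ x, v x * η x, ae_eq_of_integral_contDiff_smul_eq hv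
    continuous_const.locallyIntegrable fun ψ hψ hc => ?_⟩
  set m := ∫ x, ψ x with hm
  set χ : ℝ → ℝ := fun x => ψ x - m * η x with hχ
  have hχs : ContDiff ℝ (⊤ : ℕ∞) χ := hψ.sub (contDiff_const.mul hηs)
  have hχc : HasCompactSupport χ := hc.sub hηc.mul_left
  obtain ⟨K, hK⟩ := hχc.exists_eq_zero_of_le_abs
  have hχ0 : ∫ x, χ x = 0 := by
    rw [integral_sub (hψ.continuous.integrable_of_hasCompactSupport hc)
      ((hηs.continuous.integrable_of_hasCompactSupport hηc).const_mul m),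
      integral_const_mul, hη1]
    simp [hm]
  set θ : ℝ → ℝ := fun x => ∫ t in (-K)..x, χ t with hθ
  have hθd : ∀ x, HasDerivAt θ (χ x) x := fun x =>
    (hχs.continuous.integral_hasStrictDerivAt (-K) x).hasDerivAt
  have hθ' : deriv θ = χ := funext fun x => (hθd x).deriv
  have hθs : ContDiff ℝ (⊤ : ℕ∞) θ := by
    rw [contDiff_infty_iff_deriv, hθ']
    exact ⟨fun x => (hθd x).differentiableAt, hχs⟩
  have hθc : HasCompactSupport θ := by
    refine HasCompactSupport.intro (K := Set.Icc (-K) K) isCompact_Icc fun x hx => ?_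
    rcases lt_or_ge x (-K) with hx' | hx'
    · refine intervalIntegral.integral_zero_ae (ae_of_all _ fun t ht => hK t ?_)
      rw [Set.uIoc_of_ge hx'.le] at ht
      rw [le_abs]; right; linarith [ht.2]
    · have hxK : K < x := not_le.1 fun h' => hx ⟨hx', h'⟩
      have h1 : ∫ t in K..x, χ t = 0 := by
        refine intervalIntegral.integral_zero_ae (ae_of_all _ fun t ht => hK t ?_)
        rw [Set.uIoc_of_le hxK.le] at ht
        rw [le_abs]; left; exact ht.1.le
      have h2 := intervalIntegral.integral_add_adjacent_intervals
        (hχs.continuous.intervalIntegrable (μ := volume) (-K) K)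
        (hχs.continuous.intervalIntegrable (μ := volume) K x)
      rw [h1, ← integral_eq_intervalIntegral_of_eq_zero hK, hχ0] at h2
      simpa using h2.symm
  have hz := h θ hθs hθc
  rw [hθ'] at hz
  have hz' : ∫ x, v x * χ x = (∫ x, v x * ψ x) - m * ∫ x, v x * η x := by
    rw [← integral_const_mul, ← integral_sub (integrable_mul_test hv hψ.continuous hc)
      ((integrable_mul_test hv hηs.continuous hηc).const_mul m)]
    exact integral_congr_ae (ae_of_all _ fun x => by simp only [hχ]; ring)
  have e1 : ∫ x, ψ x • v x = ∫ x, v x * ψ x := by simp only [smul_eq_mul, mul_comm]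
  have e2 : ∫ x, ψ x • (∫ x, v x * η x) = m * ∫ x, v x * η x := by
    simp only [smul_eq_mul]; rw [integral_mul_const]
  rw [e1, e2]; linarith

theorem IsWeakDeriv.exists_isPrimitive {u g : ℝ → ℝ} (h : IsWeakDeriv 1 u g) :
    ∃ f, IsPrimitive f g ∧ u =ᵐ[volume] f := by
  have h0 := IsPrimitive.integral_primitive h.2.1 0
  set f₀ : ℝ → ℝ := fun x => ∫ t in (0 : ℝ)..x, g t
  have hl : LocallyIntegrable (fun x => u x - f₀ x) volume :=
    h.1.sub h0.continuous.locallyIntegrable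
  obtain ⟨c, hc⟩ := ae_const_of_integral_mul_deriv_eq_zero hl fun ψ hψ hψc => by
    have hd := hψ.continuous_deriv (by simp)
    have e1 := h.2.2 ψ hψ hψc
    rw [iteratedDeriv_one] at e1
    have e2 := h0.integral_mul_deriv hψ hψc
    have e3 := integral_sub (integrable_mul_test h.1 hd hψc.deriv)
      (integrable_mul_test h0.continuous.locallyIntegrable hd hψc.deriv)
    simp only [sub_mul]
    rw [e3, e1, e2]; ring
  refine ⟨fun x => f₀ x + c, ⟨h0.1, fun x y => by rw [h0.2]; ring⟩, ?_⟩
  filter_upwards [hc] with x hx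
  linarith

theorem IsWeakDeriv.isPrimitive {u g : ℝ → ℝ} (h : IsWeakDeriv 1 u g) (hu : Continuous u) :
    IsPrimitive u g := by
  obtain ⟨f, hf, hae⟩ := h.exists_isPrimitive
  rwa [(hu.ae_eq_iff_eq volume hf.continuous).1 hae]

theorem IsWeakDeriv.of_second {u p g : ℝ → ℝ} (h₁ : IsWeakDeriv 1 u p) (h₂ : IsWeakDeriv 2 u g) :
    IsWeakDeriv 1 p g := by
  refine ⟨h₁.2.1, h₂.2.1, fun ψ hψ hc => ?_⟩
  have e2 := h₂.2.2 ψ hψ hc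
  have e1 := h₁.2.2 (deriv ψ) (contDiff_infty_iff_deriv.1 hψ).2 hc.deriv
  rw [iteratedDeriv_one] at e1 ⊢
  rw [iteratedDeriv_succ', iteratedDeriv_one] at e2
  linarith

theorem IsWeakDeriv.second {u p g : ℝ → ℝ} (h₁ : IsWeakDeriv 1 u p) (h₂ : IsWeakDeriv 1 p g) :
    IsWeakDeriv 2 u g := by
  refine ⟨h₁.1, h₂.2.1, fun ψ hψ hc => ?_⟩
  have e2 := h₂.2.2 ψ hψ hc
  have e1 := h₁.2.2 (deriv ψ) (contDiff_infty_iff_deriv.1 hψ).2 hc.deriv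
  rw [iteratedDeriv_one] at e1 e2
  rw [iteratedDeriv_succ', iteratedDeriv_one]
  linarith

theorem Continuous.memLinftyLoc {f : ℝ → ℝ} (hf : Continuous f) : MemLinftyLoc f := fun K hK => by
  obtain ⟨C, hC⟩ := hK.exists_bound_of_continuousOn hf.continuousOn
  exact memLp_top_of_bound hf.aestronglyMeasurable C
    ((ae_restrict_iff' hK.measurableSet).2 (ae_of_all _ hC))

theorem MemLinftyLoc.mul {f g : ℝ → ℝ} (hf : MemLinftyLoc f) (hg : MemLinftyLoc g) :
    MemLinftyLoc fun x => f x * g x := fun K hK => (hg K hK).mul' (hf K hK)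

theorem isDecayingSolution_iff {V : ℝ → ℝ} (hV : MemLp V ⊤ volume) {l : Filter ℝ} {φ : ℝ → ℝ} :
    IsDecayingSolution V l φ ↔ (∃ p, Continuous p ∧ IsPrimitive φ p ∧
      IsPrimitive p fun x => V x * φ x) ∧ φ 0 = 1 ∧ Tendsto φ l (𝓝 0) := by
  constructor
  · rintro ⟨⟨hc, -, ⟨g, hg, -⟩, ⟨h, hh, -⟩⟩, hode, h0, hl⟩
    refine ⟨?_, h0, hl⟩
    have h2 := hh.weakDeriv.congr_ae EventuallyEq.rfl hode
    obtain ⟨p, hp, hgp⟩ := (hg.of_second h2).exists_isPrimitive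
    exact ⟨p, hp.continuous, (hg.congr_ae .rfl hgp).isPrimitive hc, hp⟩
  · rintro ⟨⟨p, hpc, hφ, hp⟩, h0, hl⟩
    have h2 := hφ.isWeakDeriv.second hp.isWeakDeriv
    exact ⟨⟨hφ.continuous, hφ.continuous.memLinftyLoc, ⟨p, hφ.isWeakDeriv, hpc.memLinftyLoc⟩,
      _, h2, MemLinftyLoc.mul (fun K _ => hV.restrict K) hφ.continuous.memLinftyLoc⟩,
      h2.weakDeriv.ae_eq h2, h0, hl⟩

/-- The bounded solution of `y' = k y - F`, for `k > 0` and bounded `F`. -/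
noncomputable def expResolvent (k : ℝ) (F : ℝ → ℝ) (x : ℝ) : ℝ :=
  Real.exp (k * x) * ∫ t in Set.Ioi x, Real.exp (-k * t) * F t

section expResolvent

variable {k : ℝ} {F G : ℝ → ℝ} {m M : ℝ}

theorem integrableOn_exp_mul_bounded (hk : 0 < k) (hF : AEStronglyMeasurable F volume)
    (hb : ∀ᵐ x, m ≤ F x ∧ F x ≤ M) (x : ℝ) :
    IntegrableOn (fun t => Real.exp (-k * t) * F t) (Set.Ioi x) := by
  refine Integrable.mul_bdd (c := max |m| |M|)
    (integrableOn_exp_mul_Ioi (neg_lt_zero.2 hk) x) hF.restrict ?_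
  filter_upwards [ae_restrict_of_ae hb] with t ht
  exact abs_le_max_abs_abs ht.1 ht.2

theorem locallyIntegrable_of_bounded (hF : AEStronglyMeasurable F volume)
    (hb : ∀ᵐ x, m ≤ F x ∧ F x ≤ M) : LocallyIntegrable F volume :=
  (memLp_top_of_bound hF (max |m| |M|) (hb.mono fun _ ht =>
    abs_le_max_abs_abs ht.1 ht.2)).locallyIntegrable le_top

theorem isPrimitive_expResolvent (hk : 0 < k) (hF : AEStronglyMeasurable F volume)
    (hb : ∀ᵐ x, m ≤ F x ∧ F x ≤ M) :
    IsPrimitive (expResolvent k F) fun x => k * expResolvent k F x - F x := by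
  have hint := integrableOn_exp_mul_bounded hk hF hb
  have hexp : ∀ c : ℝ, IsPrimitive (fun x => Real.exp (c * x)) fun x => Real.exp (c * x) * c :=
    fun c => .of_hasDerivAt (fun x => by
      simpa using ((hasDerivAt_id x).const_mul c).exp) (by fun_prop)
  have hloc : LocallyIntegrable (fun t => Real.exp (-k * t) * F t) volume := by
    simpa [mul_comm] using
      (locallyIntegrable_of_bounded hF hb).mul_continuous (hexp (-k)).continuous
  have h1 : IsPrimitive (fun x => ∫ t in Set.Ioi x, Real.exp (-k * t) * F t)
      fun t => -1 * (Real.exp (-k * t) * F t) := by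
    refine ⟨hloc.smul (-1 : ℝ), fun x y => ?_⟩
    rw [intervalIntegral.integral_const_mul,
      ← intervalIntegral.integral_Ioi_sub_Ioi' (hint x) (hint y)]
    ring
  refine ((hexp k).mul h1).congr_ae (ae_of_all _ fun x => ?_)
  have : Real.exp (k * x) * Real.exp (-k * x) = 1 := by rw [← Real.exp_add]; simp
  simp only [expResolvent]
  linear_combination (-F x) * this

theorem expResolvent_const (hk : 0 < k) (c x : ℝ) : expResolvent k (fun _ => c) x = c / k := by
  have : Real.exp (k * x) * Real.exp (-k * x) = 1 := by rw [← Real.exp_add]; simp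
  rw [expResolvent, integral_mul_const, integral_exp_mul_Ioi (neg_lt_zero.2 hk)]
  rw [neg_mul] at this ⊢
  field_simp
  linear_combination c * this

theorem expResolvent_mono (hk : 0 < k) (hF : AEStronglyMeasurable F volume)
    (hb : ∀ᵐ x, m ≤ F x ∧ F x ≤ M) {m' M' : ℝ} (hG : AEStronglyMeasurable G volume)
    (hb' : ∀ᵐ x, m' ≤ G x ∧ G x ≤ M') (h : ∀ᵐ x, F x ≤ G x) (x : ℝ) :
    expResolvent k F x ≤ expResolvent k G x := by
  refine mul_le_mul_of_nonneg_left (setIntegral_mono_ae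
    (integrableOn_exp_mul_bounded hk hF hb x) (integrableOn_exp_mul_bounded hk hG hb' x) ?_)
    (Real.exp_pos _).le
  filter_upwards [h] with t ht
  exact mul_le_mul_of_nonneg_left ht (Real.exp_pos _).le

theorem expResolvent_mem_Icc (hk : 0 < k) (hF : AEStronglyMeasurable F volume)
    (hb : ∀ᵐ x, m ≤ F x ∧ F x ≤ M) (x : ℝ) :
    m / k ≤ expResolvent k F x ∧ expResolvent k F x ≤ M / k := by
  constructor
  · rw [← expResolvent_const hk m x]
    exact expResolvent_mono hk aestronglyMeasurable_const (m := m) (M := m) (by simp) hF hb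
      (hb.mono fun _ h => h.1) x
  · rw [← expResolvent_const hk M x]
    exact expResolvent_mono hk hF hb aestronglyMeasurable_const (m' := M) (M' := M) (by simp)
      (hb.mono fun _ h => h.2) x

theorem expResolvent_sub (hk : 0 < k) (hF : AEStronglyMeasurable F volume)
    (hb : ∀ᵐ x, m ≤ F x ∧ F x ≤ M) {m' M' : ℝ} (hG : AEStronglyMeasurable G volume)
    (hb' : ∀ᵐ x, m' ≤ G x ∧ G x ≤ M') (x : ℝ) :
    expResolvent k F x - expResolvent k G x = expResolvent k (fun t => F t - G t) x := by
  simp only [expResolvent, mul_sub]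
  rw [integral_sub (integrableOn_exp_mul_bounded hk hF hb x)
    (integrableOn_exp_mul_bounded hk hG hb' x), mul_sub]

end expResolvent

/-- The Riccati equation `r' = r² - V` with `a² ≤ V ≤ b²` has a solution on `ℝ` with values in
`[a, b]`. -/
theorem exists_riccati {V : ℝ → ℝ} {a b : ℝ} (ha : 0 < a) (hab : a ≤ b)
    (hV : AEStronglyMeasurable V volume) (hb : ∀ᵐ x, a ^ 2 ≤ V x ∧ V x ≤ b ^ 2) :
    ∃ r : ℝ → ℝ, IsPrimitive r (fun x => r x ^ 2 - V x) ∧ ∀ x, a ≤ r x ∧ r x ≤ b := by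
  have hb0 : 0 < b := ha.trans_le hab
  have hk : 0 < 2 * b := by linarith
  let cl : ℝ → ℝ := fun s => max a (min b s)
  have hcl : Continuous cl := by fun_prop
  have hcl1 : ∀ s, a ≤ cl s ∧ cl s ≤ b := fun s =>
    ⟨le_max_left _ _, max_le hab (min_le_left _ _)⟩
  have hcl2 : ∀ s, a ≤ s → s ≤ b → cl s = s := fun s h1 h2 => by simp [cl, h1, h2]
  have hcl3 : ∀ s t, |cl s - cl t| ≤ |s - t| := fun s t =>
    (abs_max_sub_max_le_max _ _ _ _).trans (by
      simpa using abs_min_sub_min_le_max b s b t)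
  let F : (ℝ → ℝ) → ℝ → ℝ := fun r t => V t + b ^ 2 - (cl (r t) - b) ^ 2
  have hFm : ∀ r : BoundedContinuousFunction ℝ ℝ, AEStronglyMeasurable (F r) volume := fun r =>
    (hV.add aestronglyMeasurable_const).sub
      (((hcl.comp r.continuous).sub continuous_const).pow 2).aestronglyMeasurable
  have hFb : ∀ r : BoundedContinuousFunction ℝ ℝ, ∀ᵐ x, 2 * b * a ≤ F r x ∧ F r x ≤ 2 * b * b := by
    intro r
    filter_upwards [hb] with x hx
    obtain ⟨h1, h2⟩ := hcl1 (r x)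
    constructor
    · simp only [F]; nlinarith
    · simp only [F]; nlinarith [sq_nonneg (cl (r x) - b)]
  have hS : ∀ r : BoundedContinuousFunction ℝ ℝ, ∀ x,
      a ≤ expResolvent (2 * b) (F r) x ∧ expResolvent (2 * b) (F r) x ≤ b := by
    intro r x
    have := expResolvent_mem_Icc hk (hFm r) (hFb r) x
    rwa [mul_div_cancel_left₀ _ hk.ne', mul_div_cancel_left₀ _ hk.ne'] at this
  let T : BoundedContinuousFunction ℝ ℝ → BoundedContinuousFunction ℝ ℝ := fun r =>
    .ofNormedAddCommGroup (expResolvent (2 * b) (F r))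
      (isPrimitive_expResolvent hk (hFm r) (hFb r)).continuous b fun x => by
        rw [Real.norm_eq_abs, abs_le]; constructor <;> linarith [hS r x]
  have hT : ContractingWith (Real.toNNReal ((b - a) / b)) T := by
    have hK : 0 ≤ (b - a) / b := div_nonneg (by linarith) hb0.le
    constructor
    · rw [Real.toNNReal_lt_one, div_lt_one hb0]; linarith
    · refine LipschitzWith.of_dist_le_mul fun r s => ?_
      rw [Real.coe_toNNReal _ hK]
      refine (BoundedContinuousFunction.dist_le (by positivity)).2 fun x => ?_
      have hd : ∀ᵐ t, -(2 * (b - a) * dist r s) ≤ F r t - F s t ∧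
          F r t - F s t ≤ 2 * (b - a) * dist r s := by
        refine ae_of_all _ fun t => abs_le.1 ?_
        have e : F r t - F s t = (2 * b - cl (r t) - cl (s t)) * (cl (r t) - cl (s t)) := by
          simp only [F]; ring
        rw [e, abs_mul]
        refine mul_le_mul ?_ ((hcl3 _ _).trans ?_) (abs_nonneg _) (by linarith)
        · rw [abs_le]; constructor <;> linarith [hcl1 (r t), hcl1 (s t)]
        · rw [← Real.dist_eq]; exact r.dist_coe_le_dist t
      have := expResolvent_mem_Icc hk ((hFm r).sub (hFm s)) hd x
      change dist (expResolvent (2 * b) (F r) x) (expResolvent (2 * b) (F s) x) ≤ _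
      rw [Real.dist_eq, expResolvent_sub hk (hFm r) (hFb r) (hFm s) (hFb s), abs_le]
      have e : 2 * (b - a) * dist r s / (2 * b) = (b - a) / b * dist r s := by field_simp
      rw [neg_div, e] at this
      exact this
  obtain ⟨r, hr⟩ : ∃ r, T r = r := ⟨_, hT.fixedPoint_isFixedPt⟩
  have hr' : ∀ x, expResolvent (2 * b) (F r) x = r x := fun x => DFunLike.congr_fun hr x
  have hrb : ∀ x, a ≤ r x ∧ r x ≤ b := fun x => by rw [← hr' x]; exact hS r x
  refine ⟨r, ?_, hrb⟩
  have := isPrimitive_expResolvent hk (hFm r) (hFb r)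
  rw [funext hr'] at this
  refine this.congr_ae (ae_of_all _ fun x => ?_)
  simp only [F]
  rw [hcl2 _ (hrb x).1 (hrb x).2]; ring

/-- The function with value `1` at `0` and logarithmic derivative `-r`. -/
noncomputable def expNegPrimitive (r : ℝ → ℝ) (x : ℝ) : ℝ :=
  Real.exp (-∫ t in (0 : ℝ)..x, r t)

section expNegPrimitive

variable {V r : ℝ → ℝ} {a b : ℝ}

theorem expNegPrimitive_pos (r : ℝ → ℝ) (x : ℝ) : 0 < expNegPrimitive r x := Real.exp_pos _

theorem isPrimitive_exp_mul_integral (hr : Continuous r) (c : ℝ) :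
    IsPrimitive (fun x => Real.exp (c * ∫ t in (0 : ℝ)..x, r t))
      fun x => Real.exp (c * ∫ t in (0 : ℝ)..x, r t) * (c * r x) := by
  have hd : ∀ x, HasDerivAt (fun x => ∫ t in (0 : ℝ)..x, r t) (r x) x := fun x =>
    (hr.integral_hasStrictDerivAt 0 x).hasDerivAt
  have hc : Continuous fun x => ∫ t in (0 : ℝ)..x, r t :=
    continuous_iff_continuousAt.2 fun x => (hd x).continuousAt
  exact .of_hasDerivAt (fun x => ((hd x).const_mul c).exp) (by fun_prop)

theorem isPrimitive_expNegPrimitive (hr : Continuous r) :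
    IsPrimitive (expNegPrimitive r) fun x => -(r x * expNegPrimitive r x) := by
  have := isPrimitive_exp_mul_integral hr (-1)
  simp only [neg_one_mul] at this
  exact this.congr_ae (ae_of_all _ fun x => by simp only [expNegPrimitive]; ring)

theorem isPrimitive_deriv_expNegPrimitive (hr : IsPrimitive r fun x => r x ^ 2 - V x) :
    IsPrimitive (fun x => -(r x * expNegPrimitive r x)) fun x => V x * expNegPrimitive r x := by
  have := (hr.mul (isPrimitive_expNegPrimitive hr.continuous)).const_mul (-1)
  simp only [neg_one_mul] at this
  exact this.congr_ae (ae_of_all _ fun x => by simp only []; ring)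

theorem monotone_integral_sub (hr : Continuous r) (h : ∀ x, a ≤ r x) :
    Monotone fun x => (∫ t in (0 : ℝ)..x, r t) - a * x :=
  ((IsPrimitive.integral_primitive hr.locallyIntegrable 0).sub
    (.of_hasDerivAt (f := fun x => a * x) (g := fun _ => a)
      (fun x => by simpa using (hasDerivAt_id x).const_mul a) continuous_const)).monotone
    (ae_of_all _ fun x => sub_nonneg.2 (h x))

theorem monotone_sub_integral (hr : Continuous r) (h : ∀ x, r x ≤ b) :
    Monotone fun x => b * x - ∫ t in (0 : ℝ)..x, r t := by
  have := monotone_integral_sub hr.neg (a := -b) fun x => neg_le_neg (h x)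
  simpa [intervalIntegral.integral_neg, neg_add_eq_sub] using this

theorem min_le_integral_and_le_max (hr : Continuous r) (h : ∀ x, a ≤ r x ∧ r x ≤ b) (x : ℝ) :
    min (a * x) (b * x) ≤ ∫ t in (0 : ℝ)..x, r t ∧
      ∫ t in (0 : ℝ)..x, r t ≤ max (a * x) (b * x) := by
  have h1 := monotone_integral_sub hr fun x => (h x).1
  have h2 := monotone_sub_integral hr fun x => (h x).2
  rcases le_total 0 x with hx | hx
  · have e1 := h1 hx
    have e2 := h2 hx
    simp only [intervalIntegral.integral_same, mul_zero, sub_self] at e1 e2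
    exact ⟨(min_le_left _ _).trans (by linarith), le_trans (by linarith) (le_max_right _ _)⟩
  · have e1 := h1 hx
    have e2 := h2 hx
    simp only [intervalIntegral.integral_same, mul_zero, sub_self] at e1 e2
    exact ⟨(min_le_right _ _).trans (by linarith), le_trans (by linarith) (le_max_left _ _)⟩

theorem tendsto_integral_atTop (hr : Continuous r) (ha : 0 < a) (h : ∀ x, a ≤ r x) :
    Tendsto (fun x => ∫ t in (0 : ℝ)..x, r t) atTop atTop := by
  refine tendsto_atTop_mono' atTop ?_ (tendsto_id.const_mul_atTop ha)
  filter_upwards [eventually_ge_atTop 0] with x hx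
  have := monotone_integral_sub hr h hx
  simp only [intervalIntegral.integral_same, mul_zero, sub_self] at this
  simp only [id]; linarith

theorem isDecayingSolution_expNegPrimitive (hV : MemLp V ⊤ volume) (ha : 0 < a)
    (hr : IsPrimitive r fun x => r x ^ 2 - V x) (h : ∀ x, a ≤ r x) :
    IsDecayingSolution V atTop (expNegPrimitive r) := by
  have hc := isPrimitive_expNegPrimitive hr.continuous
  refine (isDecayingSolution_iff hV).2 ⟨⟨_, (hr.continuous.mul hc.continuous).neg, hc,
    isPrimitive_deriv_expNegPrimitive hr⟩, by simp [expNegPrimitive], ?_⟩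
  exact Real.tendsto_exp_neg_atTop_nhds_zero.comp (tendsto_integral_atTop hr.continuous ha h)

/-- Uniqueness of the decaying solution, from the factorization
`D² - V = (D - r) (D + r)` given by a Riccati solution `r`. -/
theorem IsDecayingSolution.eq_expNegPrimitive {φ : ℝ → ℝ} (hφ : IsDecayingSolution V atTop φ)
    (hV : MemLp V ⊤ volume) (ha : 0 < a) (hr : IsPrimitive r fun x => r x ^ 2 - V x)
    (h : ∀ x, a ≤ r x ∧ r x ≤ b) : φ = expNegPrimitive r := by
  obtain ⟨⟨p, hpc, hφp, hp⟩, h0, hlim⟩ := (isDecayingSolution_iff hV).1 hφ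
  have hrc := hr.continuous
  have hb : 0 < b := ha.trans_le ((h 0).1.trans (h 0).2)
  set R : ℝ → ℝ := fun x => ∫ t in (0 : ℝ)..x, r t with hR
  have hE := fun c => isPrimitive_exp_mul_integral hrc c
  have hadd : ∀ c d x, Real.exp (c * R x) * Real.exp (d * R x) = Real.exp ((c + d) * R x) :=
    fun c d x => by rw [← Real.exp_add]; ring_nf
  obtain ⟨C, hC⟩ : ∃ C, ∀ x, p x + r x * φ x = C * Real.exp (R x) := by
    refine ⟨p 0 + r 0 * φ 0, fun x => ?_⟩
    have h1 := ((hp.add (hr.mul hφp)).mul (hE (-1))).eq_of_ae_zero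
      (ae_of_all _ fun x => by simp only [Pi.zero_apply]; ring) x 0
    have h2 := hadd (-1) 1 x
    simp only [one_mul, neg_add_cancel, zero_mul, Real.exp_zero] at h2
    simp only [intervalIntegral.integral_same, mul_zero, Real.exp_zero, mul_one] at h1
    rw [← h1]
    linear_combination (-(p x + r x * φ x)) * h2
  have hprod : IsPrimitive (fun x => φ x * Real.exp (1 * R x))
      fun x => C * Real.exp (2 * R x) := by
    refine (hφp.mul (hE 1)).congr_ae (ae_of_all _ fun x => ?_)
    have h2 := hadd 1 1 x
    norm_num at h2
    simp only [one_mul]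
    rw [← h2]
    linear_combination Real.exp (R x) * hC x
  have hCz : C = 0 := by
    have hmono : Monotone fun x => C * (φ x * Real.exp (1 * R x))
        - C ^ 2 / (2 * b) * Real.exp (2 * R x) := by
      refine ((hprod.const_mul C).sub ((hE 2).const_mul (C ^ 2 / (2 * b)))).monotone
        (ae_of_all _ fun x => ?_)
      have e : C * (C * Real.exp (2 * R x))
          - C ^ 2 / (2 * b) * (Real.exp (2 * R x) * (2 * r x))
          = C ^ 2 * Real.exp (2 * R x) * (b - r x) / b := by field_simp
      simp only [Pi.zero_apply]
      rw [e]
      have := sub_nonneg.2 (h x).2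
      positivity
    have hRt : Tendsto R atTop atTop := tendsto_integral_atTop hrc ha fun x => (h x).1
    have hlim2 : Tendsto (fun x => C * φ x - (C - C ^ 2 / (2 * b)) * Real.exp (-R x)) atTop
        (𝓝 0) := by
      simpa using (hlim.const_mul C).sub
        ((Real.tendsto_exp_neg_atTop_nhds_zero.comp hRt).const_mul (C - C ^ 2 / (2 * b)))
    have hle : C ^ 2 / (2 * b) ≤ 0 := by
      refine ge_of_tendsto hlim2 ?_
      filter_upwards [eventually_ge_atTop 0, hRt.eventually_ge_atTop 0] with x hx hRx
      have h1 := hmono hx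
      simp only [hR, intervalIntegral.integral_same, mul_zero, Real.exp_zero, mul_one, h0,
        one_mul] at h1
      change _ ≤ C * (φ x * Real.exp (R x)) - C ^ 2 / (2 * b) * Real.exp (2 * R x) at h1
      have e1 := Real.exp_pos (-R x)
      have e2 : Real.exp (R x) * Real.exp (-R x) = 1 := by rw [← Real.exp_add]; simp
      have e3 : Real.exp (2 * R x) = Real.exp (R x) * Real.exp (R x) := by
        rw [← Real.exp_add]; ring_nf
      have e4 : 1 ≤ Real.exp (R x) := Real.one_le_exp hRx
      have e5 := mul_le_mul_of_nonneg_right h1 e1.le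
      have e6 : (C * (φ x * Real.exp (R x)) - C ^ 2 / (2 * b) * Real.exp (2 * R x))
          * Real.exp (-R x) = C * φ x - C ^ 2 / (2 * b) * Real.exp (R x) := by
        rw [e3]
        linear_combination (C * φ x - C ^ 2 / (2 * b) * Real.exp (R x)) * e2
      rw [e6] at e5
      have e7 : C ^ 2 / (2 * b) ≤ C ^ 2 / (2 * b) * Real.exp (R x) :=
        le_mul_of_one_le_right (by positivity) e4
      linarith
    have : C ^ 2 ≤ 0 := by
      rw [div_le_iff₀ (by linarith)] at hle; linarith
    exact pow_eq_zero_iff two_ne_zero |>.1 (le_antisymm this (sq_nonneg C))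
  funext x
  have h1 := hprod.eq_of_ae_zero (ae_of_all _ fun x => by simp [hCz]) x 0
  simp only [one_mul, hR, intervalIntegral.integral_same, Real.exp_zero, mul_one, h0] at h1
  rw [expNegPrimitive, Real.exp_neg]
  exact eq_inv_of_mul_eq_one_left h1

theorem IsDecayingSolution.comp_neg {l : Filter ℝ} {φ : ℝ → ℝ} (hV : MemLp V ⊤ volume)
    (h : IsDecayingSolution V l φ) :
    IsDecayingSolution (fun x => V (-x)) (map Neg.neg l) fun x => φ (-x) := by
  have hV' : MemLp (fun x => V (-x)) ⊤ volume :=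
    hV.comp_measurePreserving (Measure.measurePreserving_neg volume)
  obtain ⟨⟨p, hpc, hφp, hp⟩, h0, hlim⟩ := (isDecayingSolution_iff hV).1 h
  refine (isDecayingSolution_iff hV').2 ⟨⟨fun x => -p (-x), by fun_prop, hφp.comp_neg, ?_⟩,
    by simpa using h0, ?_⟩
  · simpa using hp.comp_neg.const_mul (-1)
  · rw [tendsto_map'_iff]
    simpa [Function.comp_def] using hlim

theorem expNegPrimitive_comp_neg (r : ℝ → ℝ) (x : ℝ) :
    expNegPrimitive (fun t => -r (-t)) x = expNegPrimitive r (-x) := by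
  simp only [expNegPrimitive, intervalIntegral.integral_neg]
  rw [intervalIntegral.integral_comp_neg fun t => r t, neg_zero,
    intervalIntegral.integral_symm, neg_neg]

theorem isDecayingSolution_atTop_iff (hV : MemLp V ⊤ volume) (ha : 0 < a)
    (hr : IsPrimitive r fun x => r x ^ 2 - V x) (h : ∀ x, a ≤ r x ∧ r x ≤ b) {φ : ℝ → ℝ} :
    IsDecayingSolution V atTop φ ↔ φ = expNegPrimitive r :=
  ⟨fun hφ => hφ.eq_expNegPrimitive hV ha hr h, fun hφ =>
    hφ ▸ isDecayingSolution_expNegPrimitive hV ha hr fun x => (h x).1⟩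

theorem isDecayingSolution_atBot_iff (hV : MemLp V ⊤ volume) (ha : 0 < a)
    (hr : IsPrimitive r fun x => r x ^ 2 - V x) (h : ∀ x, a ≤ -r x ∧ -r x ≤ b) {φ : ℝ → ℝ} :
    IsDecayingSolution V atBot φ ↔ φ = expNegPrimitive r := by
  have hV' : MemLp (fun x => V (-x)) ⊤ volume :=
    hV.comp_measurePreserving (Measure.measurePreserving_neg volume)
  have hr' : IsPrimitive (fun x => -r (-x)) fun x => (-r (-x)) ^ 2 - V (-x) := by
    have := hr.comp_neg.const_mul (-1)
    simpa using this
  have key := fun ψ => isDecayingSolution_atTop_iff (φ := ψ) hV' ha hr' fun x => h (-x)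
  constructor
  · intro hφ
    have h1 := hφ.comp_neg hV
    rw [map_neg_atBot, key] at h1
    funext x
    have := congrFun h1 (-x)
    simpa [expNegPrimitive_comp_neg] using this
  · rintro rfl
    have h1 := ((key _).2 rfl).comp_neg hV'
    rw [map_neg_atTop] at h1
    simpa [expNegPrimitive_comp_neg] using h1

end expNegPrimitive

section HalfLine

variable {f q V ρ w g : ℝ → ℝ} {b : ℝ}

theorem IsPrimitive.integral_Ioi_eq_neg (h : IsPrimitive f q) (hf : Integrable f)
    (hq : Integrable q) (c : ℝ) : ∫ x in Set.Ioi c, q x = -f c := by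
  have h1 := intervalIntegral_tendsto_integral_Ioi c hq.integrableOn tendsto_id
  simp only [h.2, id] at h1
  have h2 : Tendsto f atTop (𝓝 ((∫ x in Set.Ioi c, q x) + f c)) := by
    simpa using h1.add_const (f c)
  have h3 := IntegrableAtFilter.eq_zero_of_tendsto
    (⟨Set.univ, univ_mem, hf.integrableOn⟩ : IntegrableAtFilter f atTop volume)
    (fun s hs => by
      obtain ⟨d, hd⟩ := mem_atTop_sets.1 hs
      exact top_le_iff.1 (Real.volume_Ici (a := d) ▸ measure_mono hd)) h2
  linarith

theorem IsPrimitive.integral_Iic_eq (h : IsPrimitive f q) (hf : Integrable f)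
    (hq : Integrable q) (c : ℝ) : ∫ x in Set.Iic c, q x = f c := by
  have h1 := intervalIntegral_tendsto_integral_Iic c hq.integrableOn tendsto_id
  simp only [h.2, id] at h1
  have h2 : Tendsto f atBot (𝓝 (f c - ∫ x in Set.Iic c, q x)) := by
    simpa using h1.const_sub (f c)
  have h3 := IntegrableAtFilter.eq_zero_of_tendsto
    (⟨Set.univ, univ_mem, hf.integrableOn⟩ : IntegrableAtFilter f atBot volume)
    (fun s hs => by
      obtain ⟨d, hd⟩ := mem_atBot_sets.1 hs
      exact top_le_iff.1 (Real.volume_Iic (a := d) ▸ measure_mono hd)) h2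
  linarith

theorem memLp_top_of_continuous_of_abs_le (hρ : Continuous ρ) (hb : ∀ x, |ρ x| ≤ b) :
    MemLp ρ ⊤ volume :=
  memLp_top_of_bound hρ.aestronglyMeasurable b (ae_of_all _ hb)

theorem integrable_energy_density (hV : MemLp V ⊤ volume) (hw : MemLp w 2 volume)
    (hg : MemLp g 2 volume) : Integrable fun x => g x ^ 2 + V x * w x ^ 2 := by
  refine hg.integrable_sq.add ?_
  have h := MemLp.integrable_mul (p := 2) (q := 2) hw (hw.mul' hV (r := 2))
  exact h.congr (ae_of_all _ fun x => by simp only [Pi.mul_apply]; ring)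

theorem integrable_square (hρ : MemLp ρ ⊤ volume) (hw : MemLp w 2 volume)
    (hg : MemLp g 2 volume) : Integrable fun x => (g x + ρ x * w x) ^ 2 :=
  (hg.add (hw.mul' hρ (r := 2))).integrable_sq

/-- Completing the square in the energy density by means of a Riccati solution. -/
theorem isPrimitive_square_sub_energy (hρ : IsPrimitive ρ fun x => ρ x ^ 2 - V x)
    (hw : IsPrimitive w g) : IsPrimitive (fun x => ρ x * w x ^ 2)
      fun x => (g x + ρ x * w x) ^ 2 - (g x ^ 2 + V x * w x ^ 2) := by
  have := (hρ.mul (hw.mul hw)).congr_ae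
    (g₁ := fun x => (g x + ρ x * w x) ^ 2 - (g x ^ 2 + V x * w x ^ 2))
    (ae_of_all _ fun x => by simp only []; ring)
  simpa only [sq (w _)] using this

theorem integrable_mul_sq (hρ : MemLp ρ ⊤ volume) (hw : MemLp w 2 volume) :
    Integrable fun x => ρ x * w x ^ 2 :=
  (MemLp.integrable_mul (p := 2) (q := 2) hw (hw.mul' hρ (r := 2))).congr
    (ae_of_all _ fun x => by simp only [Pi.mul_apply]; ring)

theorem setIntegral_Ioi_energy (hV : MemLp V ⊤ volume)
    (hρ : IsPrimitive ρ fun x => ρ x ^ 2 - V x) (hb : ∀ x, |ρ x| ≤ b) (hw : IsPrimitive w g)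
    (hw2 : MemLp w 2 volume) (hg2 : MemLp g 2 volume) (c : ℝ) :
    ∫ x in Set.Ioi c, (g x ^ 2 + V x * w x ^ 2) =
      (∫ x in Set.Ioi c, (g x + ρ x * w x) ^ 2) + ρ c * w c ^ 2 := by
  have hρ' := memLp_top_of_continuous_of_abs_le hρ.continuous hb
  have h1 := integrable_energy_density hV hw2 hg2
  have h2 := integrable_square hρ' hw2 hg2
  have := (isPrimitive_square_sub_energy hρ hw).integral_Ioi_eq_neg
    (integrable_mul_sq hρ' hw2) (h2.sub h1) c
  rw [integral_sub h2.integrableOn h1.integrableOn] at this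
  linarith

theorem setIntegral_Iic_energy (hV : MemLp V ⊤ volume)
    (hρ : IsPrimitive ρ fun x => ρ x ^ 2 - V x) (hb : ∀ x, |ρ x| ≤ b) (hw : IsPrimitive w g)
    (hw2 : MemLp w 2 volume) (hg2 : MemLp g 2 volume) (c : ℝ) :
    ∫ x in Set.Iic c, (g x ^ 2 + V x * w x ^ 2) =
      (∫ x in Set.Iic c, (g x + ρ x * w x) ^ 2) - ρ c * w c ^ 2 := by
  have hρ' := memLp_top_of_continuous_of_abs_le hρ.continuous hb
  have h1 := integrable_energy_density hV hw2 hg2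
  have h2 := integrable_square hρ' hw2 hg2
  have := (isPrimitive_square_sub_energy hρ hw).integral_Iic_eq
    (integrable_mul_sq hρ' hw2) (h2.sub h1) c
  rw [integral_sub h2.integrableOn h1.integrableOn] at this
  linarith

theorem energyV_eq_of_isPrimitive (hw : IsPrimitive w g) :
    energyV V w = ∫ x, (g x ^ 2 + V x * w x ^ 2) := by
  refine integral_congr_ae ?_
  filter_upwards [hw.isWeakDeriv.weakDeriv.ae_eq hw.isWeakDeriv] with x hx
  rw [hx]

theorem energyV_eq_add_squares {r : ℝ → ℝ} (hV : MemLp V ⊤ volume)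
    (hr : IsPrimitive r fun x => r x ^ 2 - V x) (hrb : ∀ x, |r x| ≤ b)
    (hρ : IsPrimitive ρ fun x => ρ x ^ 2 - V x) (hρb : ∀ x, |ρ x| ≤ b) (hw : IsPrimitive w g)
    (hw2 : MemLp w 2 volume) (hg2 : MemLp g 2 volume) (c : ℝ) :
    energyV V w = (∫ x in Set.Iic c, (g x + ρ x * w x) ^ 2) +
      (∫ x in Set.Ioi c, (g x + r x * w x) ^ 2) + (r c - ρ c) * w c ^ 2 := by
  have h1 := integrable_energy_density hV hw2 hg2
  rw [energyV_eq_of_isPrimitive hw,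
    ← intervalIntegral.integral_Iic_add_Ioi (b := c) h1.integrableOn h1.integrableOn,
    setIntegral_Ioi_energy hV hr hrb hw hw2 hg2, setIntegral_Iic_energy hV hρ hρb hw hw2 hg2]
  ring

/-- If `w' + r w = 0` a.e. between `c` and `x`, then `w` is there a multiple of
`expNegPrimitive r`. -/
theorem IsPrimitive.eq_expNegPrimitive_div {r : ℝ → ℝ} (hw : IsPrimitive w g) (hr : Continuous r)
    {c x : ℝ} (h : ∀ᵐ t, t ∈ Set.uIoc c x → g t + r t * w t = 0) :
    w x = w c * (expNegPrimitive r x / expNegPrimitive r c) := by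
  have h1 := (hw.mul (isPrimitive_exp_mul_integral hr 1)).2 c x
  rw [intervalIntegral.integral_zero_ae] at h1
  · have e : ∀ y, Real.exp (1 * ∫ t in (0 : ℝ)..y, r t) = (expNegPrimitive r y)⁻¹ := fun y => by
      rw [expNegPrimitive, Real.exp_neg, inv_inv, one_mul]
    simp only [e] at h1
    have hx := (expNegPrimitive_pos r x).ne'
    have hc := (expNegPrimitive_pos r c).ne'
    field_simp at h1 ⊢
    linarith
  · filter_upwards [h] with t ht htm
    linear_combination Real.exp (1 * ∫ s in (0 : ℝ)..t, r s) * ht htm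

end HalfLine

/-- A continuous function with `|u| ≤ 1` and `u a = 1` has essential supremum norm `1`. -/
theorem eLpNorm_top_eq_one {u : ℝ → ℝ} (hu : Continuous u) (h1 : ∀ x, |u x| ≤ 1) {a : ℝ}
    (ha : u a = 1) : eLpNorm u ⊤ volume = 1 := by
  rw [eLpNorm_exponent_top]
  refine le_antisymm (essSup_le_of_ae_le 1 (ae_of_all _ fun x => ?_)) ?_
  · beta_reduce
    rw [Real.enorm_eq_ofReal_abs]
    exact ENNReal.ofReal_le_one.2 (h1 x)
  · have hcl : IsClosed {x | ‖u x‖ₑ ≤ eLpNormEssSup u volume} :=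
      isClosed_le hu.enorm continuous_const
    have hd : Dense {x | ‖u x‖ₑ ≤ eLpNormEssSup u volume} :=
      Measure.dense_of_ae (ae_le_eLpNormEssSup (f := u) (μ := volume))
    have : a ∈ {x | ‖u x‖ₑ ≤ eLpNormEssSup u volume} := by
      rw [← hcl.closure_eq]; exact hd a
    simpa [ha] using this

/-- The function equal to `1` at `a` with logarithmic derivative `-ρ` on the left and `-r` on the
right. -/
noncomputable def peakFun (ρ r : ℝ → ℝ) (a x : ℝ) : ℝ :=
  if x < a then expNegPrimitive ρ x / expNegPrimitive ρ a
  else expNegPrimitive r x / expNegPrimitive r a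

section peakFun

variable {V ρ r : ℝ → ℝ} {α β : ℝ}

theorem peakFun_self (ρ r : ℝ → ℝ) (a : ℝ) : peakFun ρ r a a = 1 := by
  simp [peakFun, (expNegPrimitive_pos r a).ne']

theorem peakFun_nonneg (ρ r : ℝ → ℝ) (a x : ℝ) : 0 ≤ peakFun ρ r a x := by
  unfold peakFun
  split_ifs <;> exact (div_pos (expNegPrimitive_pos _ _) (expNegPrimitive_pos _ _)).le

theorem isPrimitive_peakFun (hρ : Continuous ρ) (hr : Continuous r) (a : ℝ) :
    IsPrimitive (peakFun ρ r a) fun x => -((if x < a then ρ x else r x) * peakFun ρ r a x) := by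
  have h := fun s hs => (isPrimitive_expNegPrimitive (r := s) hs).const_mul (expNegPrimitive s a)⁻¹
  have h1 := (h ρ hρ).piecewise (h r hr) a (by
    rw [inv_mul_cancel₀ (expNegPrimitive_pos _ _).ne',
      inv_mul_cancel₀ (expNegPrimitive_pos _ _).ne'])
  have e : (fun x => if x < a then (expNegPrimitive ρ a)⁻¹ * expNegPrimitive ρ x
      else (expNegPrimitive r a)⁻¹ * expNegPrimitive r x) = peakFun ρ r a := by
    funext x; simp only [peakFun]; split_ifs <;> ring
  rw [e] at h1
  refine h1.congr_ae (ae_of_all _ fun x => ?_)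
  simp only [peakFun]
  split_ifs <;> ring

theorem peakFun_le_exp (hρ : Continuous ρ) (hr : Continuous r) (hρα : ∀ x, α ≤ -ρ x)
    (hrα : ∀ x, α ≤ r x) (a x : ℝ) : peakFun ρ r a x ≤ Real.exp (-(α * |x - a|)) := by
  unfold peakFun expNegPrimitive
  split_ifs with hx
  · have := monotone_sub_integral hρ (b := -α) (fun t => by linarith [hρα t]) hx.le
    simp only at this
    rw [← Real.exp_sub, Real.exp_le_exp, abs_of_neg (by linarith)]
    linarith
  · have hx := not_lt.1 hx
    have := monotone_integral_sub hr hrα hx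
    simp only at this
    rw [← Real.exp_sub, Real.exp_le_exp, abs_of_nonneg (by linarith)]
    linarith

theorem integrable_exp_neg_mul_abs_sub (hα : 0 < α) (a : ℝ) :
    Integrable fun x : ℝ => Real.exp (-(α * |x - a|)) := by
  have h : Integrable fun x : ℝ => Real.exp (-(α * |x|)) := by
    rw [← integrableOn_univ, ← Set.Iic_union_Ioi (a := (0 : ℝ))]
    refine IntegrableOn.union ?_ ?_
    · refine (integrableOn_exp_mul_Iic hα 0).congr_fun (fun x hx => ?_) measurableSet_Iic
      simp only []
      rw [abs_of_nonpos hx]; ring_nf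
    · refine (integrableOn_exp_mul_Ioi (neg_lt_zero.2 hα) 0).congr_fun (fun x hx => ?_)
        measurableSet_Ioi
      simp only []
      rw [abs_of_pos hx]; ring_nf
  exact h.comp_sub_right a

theorem memLp_two_peakFun (hα : 0 < α) (hρ : Continuous ρ) (hr : Continuous r)
    (hρα : ∀ x, α ≤ -ρ x) (hrα : ∀ x, α ≤ r x) (a : ℝ) : MemLp (peakFun ρ r a) 2 volume := by
  have hc := (isPrimitive_peakFun hρ hr a).continuous
  refine (memLp_two_iff_integrable_sq hc.aestronglyMeasurable).2 ?_
  refine (integrable_exp_neg_mul_abs_sub (mul_pos two_pos hα) a).mono'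
    (hc.pow 2).aestronglyMeasurable (ae_of_all _ fun x => ?_)
  rw [Real.norm_of_nonneg (sq_nonneg _)]
  calc peakFun ρ r a x ^ 2 ≤ Real.exp (-(α * |x - a|)) ^ 2 :=
        pow_le_pow_left₀ (peakFun_nonneg _ _ _ _) (peakFun_le_exp hρ hr hρα hrα a x) 2
    _ = Real.exp (-(2 * α * |x - a|)) := by rw [← Real.exp_nat_mul]; push_cast; ring_nf

theorem memLp_two_deriv_peakFun (hα : 0 < α) (hρ : Continuous ρ) (hr : Continuous r)
    (hρα : ∀ x, α ≤ -ρ x ∧ -ρ x ≤ β) (hrα : ∀ x, α ≤ r x ∧ r x ≤ β) (a : ℝ) :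
    MemLp (fun x => -((if x < a then ρ x else r x) * peakFun ρ r a x)) 2 volume := by
  refine (memLp_two_peakFun hα hρ hr (fun x => (hρα x).1) (fun x => (hrα x).1) a).of_le_mul
    (c := β) (isPrimitive_peakFun hρ hr a).1.aestronglyMeasurable (ae_of_all _ fun x => ?_)
  rw [norm_neg, norm_mul]
  refine mul_le_mul_of_nonneg_right ?_ (norm_nonneg _)
  rw [Real.norm_eq_abs, abs_le]
  split_ifs <;> constructor <;> linarith [hρα x, hrα x]

theorem peakFun_mem_peakSet (hα : 0 < α) (hρ : Continuous ρ) (hr : Continuous r)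
    (hρα : ∀ x, α ≤ -ρ x ∧ -ρ x ≤ β) (hrα : ∀ x, α ≤ r x ∧ r x ≤ β) (a : ℝ) :
    peakFun ρ r a ∈ peakSet a := by
  have hp := isPrimitive_peakFun hρ hr a
  refine ⟨⟨hp.continuous,
    memLp_two_peakFun hα hρ hr (fun x => (hρα x).1) (fun x => (hrα x).1) a, _, hp.isWeakDeriv,
    memLp_two_deriv_peakFun hα hρ hr hρα hrα a⟩, peakFun_self _ _ _,
    eLpNorm_top_eq_one hp.continuous (fun x => ?_) (peakFun_self ρ r a)⟩
  rw [abs_of_nonneg (peakFun_nonneg _ _ _ _)]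
  refine (peakFun_le_exp hρ hr (fun x => (hρα x).1) (fun x => (hrα x).1) a x).trans ?_
  rw [Real.exp_le_one_iff, neg_nonpos]
  positivity

theorem energyV_peakFun (hV : MemLp V ⊤ volume) (hα : 0 < α)
    (hr : IsPrimitive r fun x => r x ^ 2 - V x) (hρ : IsPrimitive ρ fun x => ρ x ^ 2 - V x)
    (hρα : ∀ x, α ≤ -ρ x ∧ -ρ x ≤ β) (hrα : ∀ x, α ≤ r x ∧ r x ≤ β) (a : ℝ) :
    energyV V (peakFun ρ r a) = r a - ρ a := by
  rw [energyV_eq_add_squares (b := β) hV hr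
    (fun x => abs_le.2 ⟨by linarith [hrα x], (hrα x).2⟩) hρ
    (fun x => abs_le.2 ⟨by linarith [hρα x], by linarith [hρα x]⟩)
    (isPrimitive_peakFun hρ.continuous hr.continuous a)
    (memLp_two_peakFun hα hρ.continuous hr.continuous (fun x => (hρα x).1)
      (fun x => (hrα x).1) a)
    (memLp_two_deriv_peakFun hα hρ.continuous hr.continuous hρα hrα a) a, peakFun_self]
  have h1 : ∫ x in Set.Iic a, (-((if x < a then ρ x else r x) * peakFun ρ r a x)
      + ρ x * peakFun ρ r a x) ^ 2 = 0 := by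
    rw [integral_Iic_eq_integral_Iio]
    refine setIntegral_eq_zero_of_forall_eq_zero fun x hx => ?_
    rw [if_pos (Set.mem_Iio.1 hx)]; ring
  have h2 : ∫ x in Set.Ioi a, (-((if x < a then ρ x else r x) * peakFun ρ r a x)
      + r x * peakFun ρ r a x) ^ 2 = 0 := by
    refine setIntegral_eq_zero_of_forall_eq_zero fun x hx => ?_
    rw [if_neg (not_lt.2 (le_of_lt hx))]; ring
  rw [h1, h2]; ring

theorem isPeakMinimizer_iff (hV : MemLp V ⊤ volume) (hα : 0 < α)
    (hr : IsPrimitive r fun x => r x ^ 2 - V x) (hρ : IsPrimitive ρ fun x => ρ x ^ 2 - V x)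
    (hρα : ∀ x, α ≤ -ρ x ∧ -ρ x ≤ β) (hrα : ∀ x, α ≤ r x ∧ r x ≤ β) (a : ℝ) (u : ℝ → ℝ) :
    IsPeakMinimizer V a u ↔ u = peakFun ρ r a := by
  have hrb : ∀ x, |r x| ≤ β := fun x => abs_le.2 ⟨by linarith [hrα x], (hrα x).2⟩
  have hρb : ∀ x, |ρ x| ≤ β := fun x => abs_le.2 ⟨by linarith [hρα x], by linarith [hρα x]⟩
  have hmem := peakFun_mem_peakSet hα hρ.continuous hr.continuous hρα hrα a
  have hen := energyV_peakFun hV hα hr hρ hρα hrα a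
  constructor
  · rintro ⟨⟨⟨huc, hu2, g, hug, hg2⟩, hua, -⟩, hmin⟩
    have hug := hug.isPrimitive huc
    have hle := hmin _ hmem
    rw [hen, energyV_eq_add_squares hV hr hrb hρ hρb hug hu2 hg2 a, hua] at hle
    have i1 := integrable_square (memLp_top_of_continuous_of_abs_le hρ.continuous hρb) hu2 hg2
    have i2 := integrable_square (memLp_top_of_continuous_of_abs_le hr.continuous hrb) hu2 hg2
    have n1 : 0 ≤ ∫ x in Set.Iic a, (g x + ρ x * u x) ^ 2 := integral_nonneg fun x => sq_nonneg _
    have n2 : 0 ≤ ∫ x in Set.Ioi a, (g x + r x * u x) ^ 2 := integral_nonneg fun x => sq_nonneg _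
    have z1 := (integral_eq_zero_iff_of_nonneg (fun x => sq_nonneg _) i1.integrableOn).1
      (le_antisymm (by linarith) n1)
    have z2 := (integral_eq_zero_iff_of_nonneg (fun x => sq_nonneg _) i2.integrableOn).1
      (le_antisymm (by linarith) n2)
    have z1' := (ae_restrict_iff' measurableSet_Iic).1 z1
    have z2' := (ae_restrict_iff' measurableSet_Ioi).1 z2
    funext x
    unfold peakFun
    split_ifs with hx
    · rw [hug.eq_expNegPrimitive_div hρ.continuous (c := a), hua, one_mul]
      filter_upwards [z1'] with t ht htm
      rw [Set.uIoc_of_ge hx.le] at htm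
      exact pow_eq_zero_iff two_ne_zero |>.1 (ht htm.2)
    · rw [hug.eq_expNegPrimitive_div hr.continuous (c := a), hua, one_mul]
      filter_upwards [z2'] with t ht htm
      rw [Set.uIoc_of_le (not_lt.1 hx)] at htm
      exact pow_eq_zero_iff two_ne_zero |>.1 (ht htm.1)
  · rintro rfl
    refine ⟨hmem, ?_⟩
    rintro w ⟨⟨hwc, hw2, g, hwg, hg2⟩, hwa, -⟩
    rw [hen, energyV_eq_add_squares hV hr hrb hρ hρb (hwg.isPrimitive hwc) hw2 hg2 a, hwa]
    have n1 : 0 ≤ ∫ x in Set.Iic a, (g x + ρ x * w x) ^ 2 := integral_nonneg fun x => sq_nonneg _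
    have n2 : 0 ≤ ∫ x in Set.Ioi a, (g x + r x * w x) ^ 2 := integral_nonneg fun x => sq_nonneg _
    linarith

end peakFun

theorem exists_riccati_neg {V : ℝ → ℝ} {a b : ℝ} (ha : 0 < a) (hab : a ≤ b)
    (hV : AEStronglyMeasurable V volume) (hb : ∀ᵐ x, a ^ 2 ≤ V x ∧ V x ≤ b ^ 2) :
    ∃ ρ : ℝ → ℝ, IsPrimitive ρ (fun x => ρ x ^ 2 - V x) ∧ ∀ x, a ≤ -ρ x ∧ -ρ x ≤ b := by
  have hm := Measure.measurePreserving_neg (volume : Measure ℝ)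
  obtain ⟨r, hr, hrb⟩ := exists_riccati ha hab (V := fun x => V (-x))
    (hV.comp_measurePreserving hm) (hm.quasiMeasurePreserving.ae hb)
  refine ⟨fun x => -r (-x), ?_, fun x => by simpa using hrb (-x)⟩
  simpa using hr.comp_neg.const_mul (-1)

theorem mainTheorem3 (V : ℝ → ℝ) (v₀ v₁ : ℝ) (hv₀ : 0 < v₀)
    (hV : MemLp V ⊤ volume) (hbdd : ∀ᵐ x, v₀ ≤ V x ∧ V x ≤ v₁) :
    (∃! φp : ℝ → ℝ, IsDecayingSolution V atTop φp) ∧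
    (∃! φm : ℝ → ℝ, IsDecayingSolution V atBot φm) ∧
    ∀ φp φm : ℝ → ℝ, IsDecayingSolution V atTop φp → IsDecayingSolution V atBot φm →
      (∀ x : ℝ,
        √(v₀ / v₁) * Real.exp (-max (√v₀ * x) (√v₁ * x)) ≤ φp x ∧
        φp x ≤ √(v₁ / v₀) * Real.exp (-min (√v₀ * x) (√v₁ * x))) ∧
      (∀ x : ℝ,
        √(v₀ / v₁) * Real.exp (min (√v₀ * x) (√v₁ * x)) ≤ φm x ∧
        φm x ≤ √(v₁ / v₀) * Real.exp (max (√v₀ * x) (√v₁ * x))) ∧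
      (∀ (a : ℝ) (u : ℝ → ℝ),
        IsPeakMinimizer V a u ↔
          u = fun x => if x < a then φm x / φm a else φp x / φp a) := by
  obtain ⟨x₀, hx₀⟩ := hbdd.exists
  have h01 : v₀ ≤ v₁ := hx₀.1.trans hx₀.2
  have hv₁ : 0 < v₁ := hv₀.trans_le h01
  have hα : 0 < √v₀ := Real.sqrt_pos.2 hv₀
  have hαβ : √v₀ ≤ √v₁ := Real.sqrt_le_sqrt h01
  have hb : ∀ᵐ x, √v₀ ^ 2 ≤ V x ∧ V x ≤ √v₁ ^ 2 := by
    rwa [Real.sq_sqrt hv₀.le, Real.sq_sqrt hv₁.le]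
  obtain ⟨r, hr, hrb⟩ := exists_riccati hα hαβ hV.aestronglyMeasurable hb
  obtain ⟨ρ, hρ, hρb⟩ := exists_riccati_neg hα hαβ hV.aestronglyMeasurable hb
  have hp := fun φ => isDecayingSolution_atTop_iff (φ := φ) hV hα hr hrb
  have hm := fun φ => isDecayingSolution_atBot_iff (φ := φ) hV hα hρ hρb
  refine ⟨⟨_, (hp _).2 rfl, fun φ hφ => (hp φ).1 hφ⟩, ⟨_, (hm _).2 rfl, fun φ hφ => (hm φ).1 hφ⟩,
    fun φp φm hφp hφm => ?_⟩
  obtain rfl := (hp _).1 hφp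
  obtain rfl := (hm _).1 hφm
  have hlow : √(v₀ / v₁) ≤ 1 := Real.sqrt_le_one.2 ((div_le_one hv₁).2 h01)
  have hupp : 1 ≤ √(v₁ / v₀) := Real.one_le_sqrt.2 ((one_le_div hv₀).2 h01)
  refine ⟨fun x => ?_, fun x => ?_, fun a u => isPeakMinimizer_iff hV hα hr hρ hρb hrb a u⟩
  · obtain ⟨h1, h2⟩ := min_le_integral_and_le_max hr.continuous hrb x
    exact ⟨(mul_le_of_le_one_left (Real.exp_pos _).le hlow).trans
        (Real.exp_le_exp.2 (by linarith)),
      le_trans (Real.exp_le_exp.2 (by linarith))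
        (le_mul_of_one_le_left (Real.exp_pos _).le hupp)⟩
  · obtain ⟨h1, h2⟩ := min_le_integral_and_le_max hρ.continuous.neg hρb x
    simp only [Pi.neg_apply, intervalIntegral.integral_neg] at h1 h2
    exact ⟨(mul_le_of_le_one_left (Real.exp_pos _).le hlow).trans (Real.exp_le_exp.2 h1),
      (Real.exp_le_exp.2 h2).trans (le_mul_of_one_le_left (Real.exp_pos _).le hupp)⟩
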